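/- Consider the planar Newtonian $N$-body problem with masses $m_1,\dots,m_N>0$. Write configurations as $x=(r_1,\dots,r_N)\in\mathbb{C}^N$, let $\mathbb{C}$ act by $z\,x=(zr_1,\dots,zr_N)$, put $U(x)=\sum_{i<j}m_im_j|r_i-r_j|^{-1}$, and let $\langle x,y\rangle=\sum_i m_i\,\mathrm{Re}(r_i\overline{s_i})$ be the mass inner product of $x=(r_i)$ and $y=(s_i)$. For a collision-free configuration $x$, let $\nabla U(x)$ be the gradient and $HU_x$ the Hessian endomorphism for this inner product: $dU_x(v)=\langle\nabla U(x),v\rangle$ and $d^2U_x(u,v)=\langle HU_x(u),v\rangle$. Motions are the collision-free solutions of $\ddot x=\nabla U(x)$. Let $x_0$ be a central configuration, i.e. a collision-free configuration with $\nabla U(x_0)=\lambda x_0$ for some $\lambda\in\mathbb{R}$. Let $S_{x_0}=\mathbb{C}x_0+\{(b,\dots,b): b\in\mathbb{C}\}$ be the space of configurations similar to $x_0$, and let $D=S_{x_0}^{\perp}$ with respect to the mass inner product. Suppose that $x_0$ is strongly non-degenerate: $\langle HU_{x_0}(v),v\rangle>0$ for all $v\in D\setminus\{0\}$. Let $x(t)=z(t)\,x_0$,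 with $z:\mathbb{R}\to\mathbb{C}$, be any elliptic homographic motion by $x_0$ (that is, a periodic one; $z$ then describes a Keplerian ellipse or circle), and let $T>0$ be a period of it. Then the linearized system $\dot J=Z$, $\dot Z=HU_{x(t)}(J)$ on $\mathbb{C}^N\times\mathbb{C}^N$ has a fundamental solution $\Phi(t)$, $t\in\mathbb{R}$, with $\Phi(0)=\mathrm{Id}$, every $\Phi(t)$ maps $D\times D$ (the essential part of the Meyer--Schmidt decomposition) into itself, and the monodromy $\Phi(T)|_{D\times D}$ is hyperbolic: none of its complex eigenvalues has modulus $1$. If moreover $N\ge 3$ (for $N=2$ the space $D$ is zero), then the motion is linearly unstable: the monodromy $\Phi(T)$ has a complex eigenvalue of modulus greater than $1$. -/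

import Mathlib

/-- Configurations `x = (r_1, …, r_n)` of `n` points in the Euclidean plane, identified with `ℂ`.
The complex scalars act by `z • x = (z r_1, …, z r_n)`. -/
abbrev Conf (n : ℕ) : Type := Fin n → ℂ

/-- Configurations without collisions, the set `Ω`. -/
def collisionFree (n : ℕ) : Set (Conf n) := {x | ∀ i j, i ≠ j → x i ≠ x j}

/-- The Newtonian potential `U(x) = ∑_{i<j} m_i m_j / |r_i - r_j|`. -/
noncomputable def newtonU {n : ℕ} (m : Fin n → ℝ) (x : Conf n) : ℝ :=
  ∑ i, ∑ j ∈ Finset.Ioi i, m i * m j / ‖x i - x j‖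

/-- The mass inner product `⟨x, y⟩ = ∑ m_i ⟨r_i, s_i⟩`, where `⟨r, s⟩ = Re r Re s + Im r Im s`. -/
noncomputable def massInner {n : ℕ} (m : Fin n → ℝ) : LinearMap.BilinForm ℝ (Conf n) :=
  LinearMap.mk₂ ℝ (fun x y => ∑ i, m i * ((x i).re * (y i).re + (x i).im * (y i).im))
    (fun x x' y => by
      simp only [Pi.add_apply, Complex.add_re, Complex.add_im, ← Finset.sum_add_distrib]
      exact Finset.sum_congr rfl fun i _ => by ring)
    (fun c x y => by
      simp only [Pi.smul_apply, Complex.smul_re, Complex.smul_im, smul_eq_mul, Finset.mul_sum]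
      exact Finset.sum_congr rfl fun i _ => by ring)
    (fun x y y' => by
      simp only [Pi.add_apply, Complex.add_re, Complex.add_im, ← Finset.sum_add_distrib]
      exact Finset.sum_congr rfl fun i _ => by ring)
    (fun c x y => by
      simp only [Pi.smul_apply, Complex.smul_re, Complex.smul_im, smul_eq_mul, Finset.mul_sum]
      exact Finset.sum_congr rfl fun i _ => by ring)

theorem massInner_apply {n : ℕ} (m : Fin n → ℝ) (x y : Conf n) :
    massInner m x y = ∑ i, m i * ((x i).re * (y i).re + (x i).im * (y i).im) := rfl

/-- The configuration that represents a linear functional with respect to the mass inner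
product; see `massInner_massRiesz`. -/
noncomputable def massRiesz {n : ℕ} (m : Fin n → ℝ) : (Conf n →L[ℝ] ℝ) →ₗ[ℝ] Conf n where
  toFun l := fun i =>
    ⟨(m i)⁻¹ * l (Pi.single i 1), (m i)⁻¹ * l (Pi.single i Complex.I)⟩
  map_add' l l' := by
    funext i
    apply Complex.ext <;> simp [mul_add]
  map_smul' c l := by
    funext i
    apply Complex.ext <;> simp [mul_left_comm]

theorem massInner_massRiesz {n : ℕ} (m : Fin n → ℝ) (hm : ∀ i, 0 < m i)
    (l : Conf n →L[ℝ] ℝ) (v : Conf n) : massInner m (massRiesz m l) v = l v := by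
  have hv : v = ∑ i, ((v i).re • (Pi.single i 1 : Conf n)
      + (v i).im • (Pi.single i Complex.I : Conf n)) := by
    funext k
    rw [Finset.sum_apply, Finset.sum_eq_single k]
    · apply Complex.ext <;> simp
    · intro i _ hik
      simp [Pi.single_eq_of_ne (Ne.symm hik)]
    · simp
  conv_rhs => rw [hv]
  rw [map_sum, massInner_apply]
  refine Finset.sum_congr rfl fun i _ => ?_
  have := (hm i).ne'
  simp only [massRiesz, LinearMap.coe_mk, AddHom.coe_mk, map_add, map_smul, smul_eq_mul]
  field_simp

/-- The gradient `∇U(x)` with respect to the mass inner product. -/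
noncomputable def gradU {n : ℕ} (m : Fin n → ℝ) (x : Conf n) : Conf n :=
  massRiesz m (fderiv ℝ (newtonU m) x)

theorem massInner_gradU {n : ℕ} (m : Fin n → ℝ) (hm : ∀ i, 0 < m i) (x v : Conf n) :
    massInner m (gradU m x) v = fderiv ℝ (newtonU m) x v :=
  massInner_massRiesz m hm _ v

/-- The Hessian endomorphism `HU_x`: the operator that represents the second derivative of `U`
at `x` with respect to the mass inner product; see `massInner_hessU`. -/
noncomputable def hessU {n : ℕ} (m : Fin n → ℝ) (x : Conf n) : Conf n →ₗ[ℝ] Conf n :=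
  massRiesz m ∘ₗ (fderiv ℝ (fderiv ℝ (newtonU m)) x).toLinearMap

theorem massInner_hessU {n : ℕ} (m : Fin n → ℝ) (hm : ∀ i, 0 < m i) (x u v : Conf n) :
    massInner m (hessU m x u) v = fderiv ℝ (fderiv ℝ (newtonU m)) x u v :=
  massInner_massRiesz m hm _ v

/-- `x₀` is a (planar) central configuration: `∇U(x₀) = lam x₀` for some real number `lam`. -/
def IsCentralConfiguration {n : ℕ} (m : Fin n → ℝ) (x₀ : Conf n) : Prop :=
  x₀ ∈ collisionFree n ∧ ∃ lam : ℝ, gradU m x₀ = lam • x₀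

/-- The space `S_{x₀} = K + Δ` of the configurations `(z r_1 + b, …, z r_n + b)`, `z, b ∈ ℂ`,
similar to `x₀`: here `K = ℂ x₀`, and `Δ` is the space of total collisions `(b, …, b)`. -/
noncomputable def similarSpace {n : ℕ} (x₀ : Conf n) : Submodule ℝ (Conf n) :=
  (Submodule.span ℂ {x₀} ⊔ Submodule.span ℂ {fun _ => 1}).restrictScalars ℝ

/-- The space `D`, the orthogonal complement of `S_{x₀}` for the mass inner product. -/
noncomputable def spaceD {n : ℕ} (m : Fin n → ℝ) (x₀ : Conf n) : Submodule ℝ (Conf n) :=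
  (massInner m).orthogonal (similarSpace x₀)

/-- The restriction of `HU_{x₀}` to `D` is positive definite. -/
def IsStronglyNondegenerate {n : ℕ} (m : Fin n → ℝ) (x₀ : Conf n) : Prop :=
  ∀ v ∈ spaceD m x₀, v ≠ 0 → 0 < massInner m (hessU m x₀ v) v

/-- `x` is a motion of the `n`-body problem, defined for all times: a collision-free solution of
`x'' = ∇U(x)`. -/
def IsMotion {n : ℕ} (m : Fin n → ℝ) (x : ℝ → Conf n) : Prop :=
  (∀ t, x t ∈ collisionFree n) ∧
    ∃ v : ℝ → Conf n, (∀ t, HasDerivAt x (v t) t) ∧ ∀ t, HasDerivAt v (gradU m (x t)) t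

/-- `x(t) = z(t) x₀` is an elliptic homographic motion by `x₀`, and `T > 0` is a period of it.
The factor `z` solves a planar Kepler problem; its periodic solutions are those that describe an
ellipse (or a circle) with a focus at the origin. -/
def IsEllipticHomographicMotion {n : ℕ} (m : Fin n → ℝ) (x₀ : Conf n) (x : ℝ → Conf n)
    (T : ℝ) : Prop :=
  IsMotion m x ∧ (∃ z : ℝ → ℂ, ∀ t, x t = z t • x₀) ∧ 0 < T ∧ Function.Periodic x T

/-- The coefficient of the linearized equations `J' = Z`, `Z' = HU_x(J)`, that is, the map
`(J, Z) ↦ (Z, HU_x(J))`. -/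
noncomputable def linearizedField {n : ℕ} (m : Fin n → ℝ) (x : Conf n) :
    (Conf n × Conf n) →L[ℝ] (Conf n × Conf n) :=
  LinearMap.toContinuousLinearMap
    ((LinearMap.snd ℝ (Conf n) (Conf n)).prod
      (hessU m x ∘ₗ LinearMap.fst ℝ (Conf n) (Conf n)))

/-- `Φ` is the linearized flow along the motion `x`: the fundamental solution, equal to the
identity at time `0`, of `J' = Z`, `Z' = HU_{x(t)}(J)`. If `x` has period `T`, then `Φ T` is
the monodromy. -/
def IsLinearizedFlow {n : ℕ} (m : Fin n → ℝ) (x : ℝ → Conf n)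
    (Φ : ℝ → (Conf n × Conf n) →L[ℝ] (Conf n × Conf n)) : Prop :=
  Φ 0 = ContinuousLinearMap.id ℝ (Conf n × Conf n) ∧
    ∀ t, HasDerivAt Φ ((linearizedField m (x t)).comp (Φ t)) t

/-- The essential part `D × D` of the Meyer–Schmidt decomposition. -/
noncomputable def essentialPart {n : ℕ} (m : Fin n → ℝ) (x₀ : Conf n) :
    Submodule ℝ (Conf n × Conf n) :=
  (spaceD m x₀).prod (spaceD m x₀)

/-- A real endomorphism is hyperbolic if it has no complex eigenvalue of modulus one. -/
def IsHyperbolicEnd {W : Type*} [AddCommGroup W] [Module ℝ W] (f : W →ₗ[ℝ] W) : Prop :=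
  ∀ μ : ℂ, Module.End.HasEigenvalue (f.baseChange ℂ) μ → ‖μ‖ ≠ 1

/-- A periodic motion with monodromy `M` is linearly unstable if some Floquet multiplier, that is,
some complex eigenvalue of `M`, has modulus greater than one. -/
def IsLinearlyUnstable {W : Type*} [AddCommGroup W] [Module ℝ W] (M : W →ₗ[ℝ] W) : Prop :=
  ∃ μ : ℂ, Module.End.HasEigenvalue (M.baseChange ℂ) μ ∧ 1 < ‖μ‖

/-! Along the linearized equations the derivative of `⟨J, Z⟩` is `⟨J, HU J⟩ + ⟨Z, Z⟩`. If `D` is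
invariant under the Hessians along the motion and they are positive definite there, this is positive
on nonzero solutions in `D × D`, so the monodromy strictly increases the quadratic form `⟨J, Z⟩`
(`IsLinearizedFlow.massInner_lt`). An eigenvalue of modulus one would preserve the sum of its values
on the real and imaginary parts of an eigenvector, a contradiction (`isHyperbolicEnd_of_lt`).

Both properties of the Hessian pass from `x₀` to `z x₀`, because `U(z x) = |z|⁻¹ U(x)` for complex
`z` and `D` is a complex subspace. At `x₀`, invariance holds because `dU` kills `D` at every
configuration similar to `x₀`; differentiating in the similar directions makes `S` and `D`
orthogonal for the Hessian.

For instability, the flow is symplectic, so its determinant has modulus one: a multiplier off the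
unit circle forces one outside. For `N ≥ 3` such a multiplier exists, since `D` is nonzero. -/

open Set MeasureTheory Topology

/-! ### Linear differential equations on the real line -/

/-- The terms of the Dyson series of the linear equation `Φ' = A Φ`, `Φ 0 = 1`. -/
noncomputable def dysonTerm {𝔸 : Type*} [NormedRing 𝔸] [NormedAlgebra ℝ 𝔸] (A : ℝ → 𝔸) :
    ℕ → ℝ → 𝔸
  | 0 => fun _ => 1
  | k + 1 => fun t => ∫ s in (0 : ℝ)..t, A s * dysonTerm A k s

section Dyson

variable {𝔸 : Type*} [NormedRing 𝔸] [NormedAlgebra ℝ 𝔸]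

theorem continuous_dysonTerm {A : ℝ → 𝔸} (hA : Continuous A) (k : ℕ) :
    Continuous (dysonTerm A k) := by
  induction k with
  | zero => exact continuous_const
  | succ k ih =>
    exact intervalIntegral.continuous_primitive
      (fun a b => (hA.mul ih).intervalIntegrable a b) 0

theorem hasDerivAt_dysonTerm_succ [CompleteSpace 𝔸] {A : ℝ → 𝔸} (hA : Continuous A) (k : ℕ) (t : ℝ) :
    HasDerivAt (dysonTerm A (k + 1)) (A t * dysonTerm A k t) t :=
  (hA.mul (continuous_dysonTerm hA k)).integral_hasStrictDerivAt 0 t |>.hasDerivAt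

/-- Iterated integration produces the factorial, hence an exponential majorant, uniform on bounded
intervals, for the series and its derivative. -/
theorem norm_dysonTerm_le {A : ℝ → 𝔸} {K R : ℝ} (hK : 0 ≤ K)
    (hAK : ∀ t ∈ Icc (-R) R, ‖A t‖ ≤ K) (k : ℕ) {t : ℝ} (ht : t ∈ Icc (-R) R) :
    ‖dysonTerm A k t‖ ≤ ‖(1 : 𝔸)‖ * ((K * |t|) ^ k / k.factorial) := by
  induction k generalizing t with
  | zero => simp [dysonTerm]
  | succ k ih =>
    have hR : (0 : ℝ) ∈ Icc (-R) R := by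
      constructor <;> linarith [ht.1, ht.2]
    calc ‖dysonTerm A (k + 1) t‖
        ≤ ∫ s in uIoc 0 t, ‖(1 : 𝔸)‖ * (K ^ (k + 1) / k.factorial) * |s - 0| ^ k := by
          rw [dysonTerm, intervalIntegral.norm_intervalIntegral_eq]
          refine norm_integral_le_of_norm_le (Continuous.integrableOn_uIoc (by fun_prop)) ?_
          refine (ae_restrict_mem measurableSet_uIoc).mono fun s hs => ?_
          have hs' : s ∈ Icc (-R) R :=
            (uIoc_subset_uIcc.trans (uIcc_subset_Icc hR ht)) hs
          calc ‖A s * dysonTerm A k s‖ ≤ ‖A s‖ * ‖dysonTerm A k s‖ := norm_mul_le _ _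
            _ ≤ K * (‖(1 : 𝔸)‖ * ((K * |s|) ^ k / k.factorial)) :=
              mul_le_mul (hAK s hs') (ih hs') (norm_nonneg _) hK
            _ = _ := by rw [sub_zero, mul_pow, pow_succ]; ring
      _ = _ := by
          rw [integral_const_mul, integral_pow_abs_sub_uIoc, sub_zero, Nat.factorial_succ, mul_pow]
          push_cast
          field_simp

theorem exists_linear_flow [CompleteSpace 𝔸] (A : ℝ → 𝔸) (hA : Continuous A) :
    ∃ Φ : ℝ → 𝔸, Φ 0 = 1 ∧ ∀ t, HasDerivAt Φ (A t * Φ t) t := by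
  have h0 : ∀ k, dysonTerm A (k + 1) 0 = 0 := fun k => by simp [dysonTerm]
  refine ⟨fun t => ∑' k, dysonTerm A k t, ?_, fun t => ?_⟩
  · refine (tsum_eq_single 0 fun k hk => ?_).trans rfl
    obtain ⟨j, rfl⟩ := Nat.exists_eq_succ_of_ne_zero hk
    exact h0 j
  · set R := |t| + 1
    have hR : 0 < R := by positivity
    obtain ⟨K, hAK⟩ := (isCompact_Icc (a := -R) (b := R)).exists_bound_of_continuousOn
      hA.continuousOn
    have hK : 0 ≤ K := (norm_nonneg _).trans (hAK 0 ⟨by linarith, hR.le⟩)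
    have hsub : Ioo (-R) R ⊆ Icc (-R) R := Ioo_subset_Icc_self
    have hbound : ∀ k, ∀ s ∈ Ioo (-R) R,
        ‖dysonTerm A k s‖ ≤ ‖(1 : 𝔸)‖ * ((K * R) ^ k / k.factorial) := fun k s hs => by
      refine (norm_dysonTerm_le hK hAK k (hsub hs)).trans ?_
      have : |s| ≤ R := (abs_lt.mpr hs).le
      gcongr
    have hsum : Summable fun k : ℕ => ‖(1 : 𝔸)‖ * ((K * R) ^ k / k.factorial) :=
      (Real.summable_pow_div_factorial (K * R)).mul_left _
    have htR : t ∈ Ioo (-R) R := abs_lt.mp (by simp [R])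
    have hsummable : ∀ s ∈ Ioo (-R) R, Summable fun k => dysonTerm A k s := fun s hs =>
      Summable.of_norm_bounded hsum fun k => hbound k s hs
    -- The series is differentiated without its constant term, so each derivative is `A` times the
    -- preceding term; all these terms vanish at `0`, which gives convergence at one point.
    have hderiv := hasDerivAt_tsum_of_isPreconnected (hsum.mul_left K) isOpen_Ioo isPreconnected_Ioo
      (fun k s _ => hasDerivAt_dysonTerm_succ hA k s)
      (fun k s hs => (norm_mul_le _ _).trans
        (mul_le_mul (hAK s (hsub hs)) (hbound k s hs) (norm_nonneg _) hK))
      (show (0 : ℝ) ∈ Ioo (-R) R from ⟨by linarith, hR⟩)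
      (by simpa only [h0] using summable_zero) htR
    rw [(hsummable t htR).tsum_mul_left] at hderiv
    refine (hderiv.const_add 1).congr_of_eventuallyEq ?_
    filter_upwards [isOpen_Ioo.mem_nhds htR] with s hs
    rw [(hsummable s hs).tsum_eq_zero_add]
    rfl

end Dyson

section Uniqueness

variable {E : Type*} [NormedAddCommGroup E] [NormedSpace ℝ E]

theorem eq_zero_of_linear_ode {A : ℝ → E →L[ℝ] E} (hA : Continuous A) {u : ℝ → E}
    (hu : ∀ t, HasDerivAt u (A t (u t)) t) (h0 : u 0 = 0) (t : ℝ) : u t = 0 := by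
  set R := |t| + 1
  have hR : 0 < R := by positivity
  obtain ⟨K, hAK⟩ := (isCompact_Icc (a := -R) (b := R)).exists_bound_of_continuousOn
    hA.continuousOn
  have hunique := ODE_solution_unique_of_mem_Ioo (v := fun s => A s) (s := fun _ => univ)
    (K := K.toNNReal) (a := -R) (b := R) (t₀ := 0) (f := u) (g := fun _ => 0)
    (fun s hs => ((A s).lipschitz.weaken (by
      rw [← NNReal.coe_le_coe]
      exact (hAK s (Ioo_subset_Icc_self hs)).trans (Real.le_coe_toNNReal K))).lipschitzOnWith)
    ⟨by linarith, hR⟩ (fun s _ => ⟨hu s, mem_univ _⟩)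
    (fun s _ => ⟨by simpa using hasDerivAt_const s (0 : E), mem_univ _⟩) h0
  exact hunique (abs_lt.mp (by simp [R]))

/-- For a projection `q` with kernel `W`, invariance gives `q A = q A q`, so `q u` solves a linear
equation with zero initial value. -/
theorem mem_submodule_of_linear_ode [FiniteDimensional ℝ E] {A : ℝ → E →L[ℝ] E}
    (hA : Continuous A) {W : Submodule ℝ E} (hW : ∀ t, ∀ w ∈ W, A t w ∈ W) {u : ℝ → E}
    (hu : ∀ t, HasDerivAt u (A t (u t)) t) (h0 : u 0 ∈ W) (t : ℝ) : u t ∈ W := by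
  obtain ⟨W', hWW'⟩ := W.exists_isCompl
  set q : E →L[ℝ] E := LinearMap.toContinuousLinearMap (Submodule.projection W' W hWW'.symm) with hq
  have hker : ∀ w, q w = 0 ↔ w ∈ W := fun w => by
    simp [hq, Submodule.projection_apply_eq_zero_iff]
  have hsub : ∀ w, w - q w ∈ W := fun w => by
    rw [← hker, map_sub, sub_eq_zero]
    exact (Submodule.projection_apply_of_mem_left _ (Submodule.projection_apply_mem _ w)).symm
  have hqA : ∀ s w, q (A s (q w)) = q (A s w) := fun s w => by
    rw [eq_comm, ← sub_eq_zero, ← map_sub, ← map_sub, hker]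
    exact hW s _ (hsub w)
  rw [← hker]
  refine eq_zero_of_linear_ode (A := fun s => q.comp (A s)) (u := fun s => q (u s))
    (continuous_const.clm_comp hA) (fun s => ?_) ((hker _).2 h0) t
  have := q.hasFDerivAt.comp_hasDerivAt s (hu s)
  rwa [← hqA] at this

end Uniqueness

/-! ### Complex eigenvalues of real endomorphisms -/

open TensorProduct Polynomial

section Eigenvalues

variable {W : Type*} [AddCommGroup W] [Module ℝ W]

theorem exists_eq_one_tmul_add_I_tmul (w : ℂ ⊗[ℝ] W) :
    ∃ a b : W, w = (1 : ℂ) ⊗ₜ[ℝ] a + Complex.I ⊗ₜ[ℝ] b := by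
  obtain ⟨c, rfl⟩ := TensorProduct.eq_repr_basis_left Complex.basisOneI w
  refine ⟨c 0, c 1, ?_⟩
  rw [Finsupp.sum_fintype _ _ (by simp), Fin.sum_univ_two]
  simp

theorem one_tmul_add_I_tmul_inj {a b a' b' : W} :
    (1 : ℂ) ⊗ₜ[ℝ] a + Complex.I ⊗ₜ[ℝ] b = (1 : ℂ) ⊗ₜ[ℝ] a' + Complex.I ⊗ₜ[ℝ] b' ↔
      a = a' ∧ b = b' := by
  refine ⟨fun h => ?_, fun h => by rw [h.1, h.2]⟩
  have h' := congrArg (TensorProduct.equivFinsuppOfBasisLeft (N := W) Complex.basisOneI) h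
  have h1 : Complex.basisOneI.repr 1 = Finsupp.single 0 1 := by
    rw [← Complex.basisOneI.repr_self]; simp
  have hI : Complex.basisOneI.repr Complex.I = Finsupp.single 1 1 := by
    rw [← Complex.basisOneI.repr_self]; simp
  simp only [map_add, TensorProduct.equivFinsuppOfBasisLeft_apply_tmul, h1, hI] at h'
  exact ⟨by simpa using DFunLike.congr_fun h' 0, by simpa using DFunLike.congr_fun h' 1⟩

/-- Here `a` and `b` are the real and imaginary parts of a complex eigenvector; later arguments can
then stay over `ℝ`. -/
theorem hasEigenvalue_baseChange_iff (f : W →ₗ[ℝ] W) (μ : ℂ) :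
    Module.End.HasEigenvalue (f.baseChange ℂ) μ ↔ ∃ a b : W, (a ≠ 0 ∨ b ≠ 0) ∧
      f a = μ.re • a - μ.im • b ∧ f b = μ.im • a + μ.re • b := by
  have hsmul : ∀ a b : W, μ • ((1 : ℂ) ⊗ₜ[ℝ] a + Complex.I ⊗ₜ[ℝ] b) =
      (1 : ℂ) ⊗ₜ[ℝ] (μ.re • a - μ.im • b) + Complex.I ⊗ₜ[ℝ] (μ.im • a + μ.re • b) :=
    fun a b => by
      have h1 : μ * 1 = μ.re • (1 : ℂ) + μ.im • Complex.I := by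
        apply Complex.ext <;> simp
      have h2 : μ * Complex.I = μ.re • Complex.I - μ.im • (1 : ℂ) := by
        apply Complex.ext <;> simp
      rw [smul_add, TensorProduct.smul_tmul', TensorProduct.smul_tmul', smul_eq_mul, smul_eq_mul,
        h1, h2]
      simp only [TensorProduct.add_tmul, TensorProduct.sub_tmul, TensorProduct.tmul_add,
        TensorProduct.tmul_sub, TensorProduct.smul_tmul]
      abel
  have hzero : ∀ a b : W, (1 : ℂ) ⊗ₜ[ℝ] a + Complex.I ⊗ₜ[ℝ] b = 0 ↔ a = 0 ∧ b = 0 :=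
    fun a b => by
      rw [← one_tmul_add_I_tmul_inj]
      simp
  have heq : ∀ a b : W, f.baseChange ℂ ((1 : ℂ) ⊗ₜ[ℝ] a + Complex.I ⊗ₜ[ℝ] b) =
      μ • ((1 : ℂ) ⊗ₜ[ℝ] a + Complex.I ⊗ₜ[ℝ] b) ↔
        f a = μ.re • a - μ.im • b ∧ f b = μ.im • a + μ.re • b := fun a b => by
    rw [hsmul, map_add, LinearMap.baseChange_tmul, LinearMap.baseChange_tmul,
      one_tmul_add_I_tmul_inj]
  constructor
  · intro h
    obtain ⟨w, hw⟩ := h.exists_hasEigenvector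
    obtain ⟨a, b, rfl⟩ := exists_eq_one_tmul_add_I_tmul w
    refine ⟨a, b, ?_, (heq a b).1 hw.apply_eq_smul⟩
    have := hw.2
    rw [Ne, hzero] at this
    tauto
  · rintro ⟨a, b, hab, h⟩
    refine Module.End.hasEigenvalue_of_hasEigenvector
      (x := (1 : ℂ) ⊗ₜ[ℝ] a + Complex.I ⊗ₜ[ℝ] b)
      ⟨Module.End.mem_eigenspace_iff.2 ((heq a b).2 h), ?_⟩
    rw [Ne, hzero]
    tauto

theorem hasEigenvalue_baseChange_of_restrict {f : W →ₗ[ℝ] W} {p : Submodule ℝ W}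
    (hp : ∀ w ∈ p, f w ∈ p) {μ : ℂ}
    (h : Module.End.HasEigenvalue ((f.restrict hp).baseChange ℂ) μ) :
    Module.End.HasEigenvalue (f.baseChange ℂ) μ := by
  rw [hasEigenvalue_baseChange_iff] at h ⊢
  obtain ⟨a, b, hab, ha, hb⟩ := h
  exact ⟨a, b, by simpa using hab, by simpa using congrArg Subtype.val ha,
    by simpa using congrArg Subtype.val hb⟩

variable [FiniteDimensional ℝ W]

/-- An endomorphism of determinant `±1` with an eigenvalue off the unit circle has one outside the
closed unit disc. -/
theorem isLinearlyUnstable_of_det_sq {f : W →ₗ[ℝ] W} (hdet : LinearMap.det f ^ 2 = 1) {μ : ℂ}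
    (hμ : Module.End.HasEigenvalue (f.baseChange ℂ) μ) (hμ1 : ‖μ‖ ≠ 1) :
    IsLinearlyUnstable f := by
  by_contra hcon
  simp only [IsLinearlyUnstable, not_exists, not_and, not_lt] at hcon
  set g : Module.End ℂ (ℂ ⊗[ℝ] W) := f.baseChange ℂ
  have hprod : LinearMap.det g = g.charpoly.roots.prod :=
    Module.End.det_eq_prod_roots_charpoly_of_splits (IsAlgClosed.splits _)
  have hroot : ∀ ν ∈ g.charpoly.roots, ‖ν‖ ≤ 1 := fun ν hν =>
    hcon ν ((Module.End.hasEigenvalue_iff_isRoot_charpoly g ν).2 (Polynomial.isRoot_of_mem_roots hν))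
  have hμroot : μ ∈ g.charpoly.roots :=
    (Polynomial.mem_roots g.charpoly_monic.ne_zero).2
      ((Module.End.hasEigenvalue_iff_isRoot_charpoly g μ).1 hμ)
  obtain ⟨s, hs⟩ := Multiset.exists_cons_of_mem hμroot
  have hs1 : ‖s.prod‖ ≤ 1 := by
    have hs' : ∀ ν ∈ s, ‖ν‖ ≤ 1 := fun ν hν => hroot ν (hs ▸ Multiset.mem_cons_of_mem hν)
    clear hs
    induction s using Multiset.induction_on with
    | empty => simp
    | cons a s ih =>
      rw [Multiset.prod_cons, norm_mul]
      exact mul_le_one₀ (hs' a (Multiset.mem_cons_self a s)) (norm_nonneg _)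
        (ih fun ν hν => hs' ν (Multiset.mem_cons_of_mem hν))
  have hdet1 : ‖LinearMap.det g‖ = 1 := by
    have hbase : LinearMap.det g = ((LinearMap.det f : ℝ) : ℂ) := LinearMap.det_baseChange f
    rw [hbase, Complex.norm_real, Real.norm_eq_abs]
    rcases eq_or_eq_neg_of_sq_eq_sq (LinearMap.det f) 1 (by rw [hdet, one_pow]) with h | h <;> simp [h]
  -- If no root lies outside the disc, the root `μ` strictly inside makes the product of all roots
  -- smaller than one in modulus.
  have hlt : ‖μ‖ < 1 := lt_of_le_of_ne (hcon μ hμ) hμ1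
  rw [hprod, hs, Multiset.prod_cons, norm_mul] at hdet1
  nlinarith [norm_nonneg μ, norm_nonneg s.prod]

/-- Take determinants in `Fᵀ G F = G`, with `G` the invertible Gram matrix of `B`. -/
theorem det_sq_eq_one_of_comp_eq {B : LinearMap.BilinForm ℝ W} (hB : B.Nondegenerate)
    {f : W →ₗ[ℝ] W} (hf : ∀ u v, B (f u) (f v) = B u v) : LinearMap.det f ^ 2 = 1 := by
  classical
  set b := Module.finBasis ℝ W
  have hcomp : B.comp f f = B := by ext u v; exact hf u v
  have h := congrArg Matrix.det (LinearMap.BilinForm.toMatrix_comp b b B f f)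
  rw [hcomp, Matrix.det_mul, Matrix.det_mul, Matrix.det_transpose, LinearMap.det_toMatrix] at h
  have hne := (LinearMap.BilinForm.nondegenerate_iff_det_ne_zero b).1 hB
  have : (LinearMap.BilinForm.toMatrix b B).det * (LinearMap.det f ^ 2 - 1) = 0 := by
    linear_combination -h
  linarith [(mul_eq_zero.1 this).resolve_left hne]

end Eigenvalues

theorem HasFDerivAt.clm_apply_vec {E F G : Type*} [NormedAddCommGroup E] [NormedSpace ℝ E]
    [NormedAddCommGroup F] [NormedSpace ℝ F] [NormedAddCommGroup G] [NormedSpace ℝ G]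
    {f : E → F →L[ℝ] G} {f' : E →L[ℝ] F →L[ℝ] G} {x : E} (h : HasFDerivAt f f' x) (v : F) :
    HasFDerivAt (fun y => f y v) (f'.flip v) x :=
  (ContinuousLinearMap.apply ℝ G v).hasFDerivAt.comp x h

/-! ### The Newtonian potential: smoothness, homogeneity and invariance. -/

section Potential

variable {n : ℕ}

theorem contDiffAt_newtonU (m : Fin n → ℝ) {x : Conf n} (hx : x ∈ collisionFree n) {k : ℕ∞} :
    ContDiffAt ℝ k (newtonU m) x := by
  unfold newtonU
  refine ContDiffAt.sum fun i _ => ContDiffAt.sum fun j hj => ?_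
  have hij : x i - x j ≠ 0 := sub_ne_zero.2 (hx i j (Finset.mem_Ioi.1 hj).ne)
  refine contDiffAt_const.div ?_ (norm_ne_zero_iff.2 hij)
  exact ContDiffAt.norm ℝ (by fun_prop) hij

theorem contDiffAt_fderiv_newtonU (m : Fin n → ℝ) {x : Conf n} (hx : x ∈ collisionFree n)
    {k : ℕ∞} : ContDiffAt ℝ k (fderiv ℝ (newtonU m)) x :=
  (contDiffAt_newtonU m hx (k := k + 1)).fderiv_right (by simp)

theorem differentiableAt_fderiv_newtonU (m : Fin n → ℝ) {x : Conf n}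
    (hx : x ∈ collisionFree n) : DifferentiableAt ℝ (fderiv ℝ (newtonU m)) x :=
  (contDiffAt_fderiv_newtonU m hx (k := 1)).differentiableAt (by simp)

theorem continuousAt_fderiv_fderiv_newtonU (m : Fin n → ℝ) {x : Conf n}
    (hx : x ∈ collisionFree n) : ContinuousAt (fderiv ℝ (fderiv ℝ (newtonU m))) x :=
  ((contDiffAt_fderiv_newtonU m hx (k := 1)).fderiv_right (m := 0) (by simp)).continuousAt

theorem fderiv_fderiv_newtonU_comm (m : Fin n → ℝ) {x : Conf n} (hx : x ∈ collisionFree n)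
    (u v : Conf n) :
    fderiv ℝ (fderiv ℝ (newtonU m)) x u v = fderiv ℝ (fderiv ℝ (newtonU m)) x v u :=
  (contDiffAt_newtonU m hx (k := 2)).isSymmSndFDerivAt (by simp) u v

theorem massInner_comm (m : Fin n → ℝ) (x y : Conf n) : massInner m x y = massInner m y x := by
  simp only [massInner_apply, mul_comm]

theorem massInner_self_pos {m : Fin n → ℝ} (hm : ∀ i, 0 < m i) {x : Conf n} (hx : x ≠ 0) :
    0 < massInner m x x := by
  rw [massInner_apply]
  obtain ⟨i, hi⟩ := Function.ne_iff.1 hx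
  have hnorm : ∀ j, (x j).re * (x j).re + (x j).im * (x j).im = Complex.normSq (x j) :=
    fun j => (Complex.normSq_apply _).symm
  simp only [hnorm]
  exact Finset.sum_pos' (fun j _ => mul_nonneg (hm j).le (Complex.normSq_nonneg _))
    ⟨i, Finset.mem_univ i, mul_pos (hm i) (Complex.normSq_pos.2 hi)⟩

theorem massInner_smul_left (m : Fin n → ℝ) (z : ℂ) (x y : Conf n) :
    massInner m (z • x) y = massInner m x ((starRingEnd ℂ z) • y) := by
  simp only [massInner_apply, Pi.smul_apply, smul_eq_mul, Complex.mul_re, Complex.mul_im,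
    Complex.conj_re, Complex.conj_im]
  exact Finset.sum_congr rfl fun i _ => by ring

theorem massInner_hessU_comm {m : Fin n → ℝ} (hm : ∀ i, 0 < m i) {x : Conf n}
    (hx : x ∈ collisionFree n) (u v : Conf n) :
    massInner m (hessU m x u) v = massInner m u (hessU m x v) := by
  rw [massInner_comm m u, massInner_hessU m hm, massInner_hessU m hm,
    fderiv_fderiv_newtonU_comm m hx]

theorem mem_spaceD_iff {m : Fin n → ℝ} {x₀ v : Conf n} :
    v ∈ spaceD m x₀ ↔ ∀ s ∈ similarSpace x₀, massInner m s v = 0 := Iff.rfl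

theorem smul_mem_similarSpace {x₀ s : Conf n} (z : ℂ) (hs : s ∈ similarSpace x₀) :
    z • s ∈ similarSpace x₀ :=
  (Submodule.span ℂ {x₀} ⊔ Submodule.span ℂ {fun _ => 1}).smul_mem z hs

theorem smul_mem_spaceD {m : Fin n → ℝ} {x₀ v : Conf n} (z : ℂ) (hv : v ∈ spaceD m x₀) :
    z • v ∈ spaceD m x₀ := fun s hs => by
  have h := hv _ (smul_mem_similarSpace (starRingEnd ℂ z) hs)
  change massInner m s (z • v) = 0
  rw [massInner_comm, massInner_smul_left, massInner_comm]
  exact h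

theorem mem_similarSpace_iff {x₀ s : Conf n} :
    s ∈ similarSpace x₀ ↔ ∃ a b : ℂ, s = a • x₀ + b • fun _ => 1 := by
  rw [similarSpace, Submodule.restrictScalars_mem, Submodule.mem_sup]
  simp only [Submodule.mem_span_singleton]
  constructor
  · rintro ⟨_, ⟨a, rfl⟩, _, ⟨b, rfl⟩, rfl⟩
    exact ⟨a, b, rfl⟩
  · rintro ⟨a, b, rfl⟩
    exact ⟨_, ⟨a, rfl⟩, _, ⟨b, rfl⟩, rfl⟩

theorem smul_add_const_mem_collisionFree {x : Conf n} (hx : x ∈ collisionFree n) {z : ℂ}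
    (hz : z ≠ 0) (b : ℂ) : z • x + (b • fun _ => (1 : ℂ)) ∈ collisionFree n := fun i j hij => by
  simpa [hz] using hx i j hij

theorem newtonU_smul (m : Fin n → ℝ) (z : ℂ) (x : Conf n) :
    newtonU m (z • x) = ‖z‖⁻¹ * newtonU m x := by
  simp only [newtonU, Finset.mul_sum, Pi.smul_apply, smul_eq_mul, ← mul_sub, norm_mul]
  refine Finset.sum_congr rfl fun i _ => Finset.sum_congr rfl fun j _ => ?_
  rw [div_eq_mul_inv, div_eq_mul_inv, mul_inv]
  ring

theorem newtonU_add_const (m : Fin n → ℝ) (x : Conf n) (b : ℂ) :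
    newtonU m (x + b • fun _ => 1) = newtonU m x := by
  simp [newtonU]

/-- Multiplication of configurations by a nonzero complex number. -/
noncomputable def confSMul {z : ℂ} (hz : z ≠ 0) : Conf n ≃L[ℝ] Conf n :=
  (ContinuousLinearEquiv.smulLeft (R₁ := ℂ) (M₁ := Conf n) (Units.mk0 z hz)).restrictScalars ℝ

theorem confSMul_apply {z : ℂ} (hz : z ≠ 0) (x : Conf n) : confSMul hz x = z • x := rfl

theorem fderiv_newtonU_smul (m : Fin n → ℝ) {z : ℂ} (hz : z ≠ 0) (x u : Conf n) :
    fderiv ℝ (newtonU m) (z • x) (z • u) = ‖z‖⁻¹ * fderiv ℝ (newtonU m) x u := by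
  have h : newtonU m ∘ (confSMul hz : Conf n → Conf n) = ‖z‖⁻¹ • newtonU m := by
    funext y
    exact newtonU_smul m z y
  have h' := congrFun (congrArg (fderiv ℝ) h) x
  rw [ContinuousLinearEquiv.comp_right_fderiv, fderiv_const_smul_field] at h'
  exact DFunLike.congr_fun h' u

theorem fderiv_newtonU_add_const (m : Fin n → ℝ) (x : Conf n) (b : ℂ) :
    fderiv ℝ (newtonU m) (x + b • fun _ => 1) = fderiv ℝ (newtonU m) x := by
  rw [← fderiv_comp_add_right]
  simp only [newtonU_add_const]

/-- The first-order homogeneity identity, differentiated once more; complex `z` covers rotation and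
scaling together. -/
theorem fderiv_fderiv_newtonU_smul (m : Fin n → ℝ) {z : ℂ} (hz : z ≠ 0) {x : Conf n}
    (hx : x ∈ collisionFree n) (u v : Conf n) :
    fderiv ℝ (fderiv ℝ (newtonU m)) (z • x) (z • u) (z • v) =
      ‖z‖⁻¹ * fderiv ℝ (fderiv ℝ (newtonU m)) x u v := by
  have hzx : z • x ∈ collisionFree n := by
    simpa using smul_add_const_mem_collisionFree hx hz 0
  have h : (fun y => fderiv ℝ (newtonU m) (confSMul hz y) (z • v)) =
      fun y => ‖z‖⁻¹ * fderiv ℝ (newtonU m) y v := by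
    funext y
    exact fderiv_newtonU_smul m hz y v
  have hl : HasFDerivAt (fun y => fderiv ℝ (newtonU m) (confSMul hz y) (z • v))
      (((fderiv ℝ (fderiv ℝ (newtonU m)) (z • x)).comp
        (confSMul hz).toContinuousLinearMap).flip (z • v)) x := by
    have h1 := (differentiableAt_fderiv_newtonU m hzx).hasFDerivAt
    rw [← confSMul_apply hz x] at h1
    exact (h1.comp x (confSMul hz).hasFDerivAt).clm_apply_vec _
  have hr : HasFDerivAt (fun y => ‖z‖⁻¹ * fderiv ℝ (newtonU m) y v)
      (‖z‖⁻¹ • (fderiv ℝ (fderiv ℝ (newtonU m)) x).flip v) x :=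
    ((differentiableAt_fderiv_newtonU m hx).hasFDerivAt.clm_apply_vec v).const_mul _
  rw [h] at hl
  exact DFunLike.congr_fun (hl.unique hr) u

end Potential

/-! ### The splitting `S ⊕ D` at a central configuration. -/

section CentralConfiguration

variable {n : ℕ} {m : Fin n → ℝ} {x₀ : Conf n}

/-- Homogeneity moves the derivative to `x₀`, where the gradient is a multiple of `x₀ ∈ S`; the
vector `z⁻¹ v` is still in `D`. -/
theorem fderiv_newtonU_similar_eq_zero (hm : ∀ i, 0 < m i) (hcc : IsCentralConfiguration m x₀)
    {v : Conf n} (hv : v ∈ spaceD m x₀) {z : ℂ} (hz : z ≠ 0) (b : ℂ) :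
    fderiv ℝ (newtonU m) (z • x₀ + b • fun _ => 1) v = 0 := by
  obtain ⟨-, lam, hlam⟩ := hcc
  have h := fderiv_newtonU_smul m hz x₀ (z⁻¹ • v)
  have hx₀ : x₀ ∈ similarSpace x₀ := mem_similarSpace_iff.2 ⟨1, 0, by simp⟩
  rw [smul_inv_smul₀ hz, ← massInner_gradU m hm x₀, hlam, LinearMap.map_smul (massInner m), LinearMap.smul_apply,
    mem_spaceD_iff.1 (smul_mem_spaceD z⁻¹ hv) _ hx₀] at h
  rw [fderiv_newtonU_add_const, h]
  simp

theorem fderiv_fderiv_newtonU_similar_eq_zero (hm : ∀ i, 0 < m i)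
    (hcc : IsCentralConfiguration m x₀) {s v : Conf n} (hs : s ∈ similarSpace x₀)
    (hv : v ∈ spaceD m x₀) : fderiv ℝ (fderiv ℝ (newtonU m)) x₀ s v = 0 := by
  obtain ⟨a, b, hs_def⟩ := mem_similarSpace_iff.1 hs
  have hline : HasDerivAt (fun ε : ℝ => x₀ + ε • s) s 0 := by
    simpa using ((hasDerivAt_id (0 : ℝ)).smul_const s).const_add x₀
  have hd : HasFDerivAt (fderiv ℝ (newtonU m)) (fderiv ℝ (fderiv ℝ (newtonU m)) x₀)
      (x₀ + (0 : ℝ) • s) := by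
    simpa using (differentiableAt_fderiv_newtonU m hcc.1).hasFDerivAt
  have h1 : HasDerivAt (fun ε : ℝ => fderiv ℝ (newtonU m) (x₀ + ε • s) v)
      (fderiv ℝ (fderiv ℝ (newtonU m)) x₀ s v) 0 :=
    HasFDerivAt.comp_hasDerivAt (0 : ℝ) (f := fun ε : ℝ => x₀ + ε • s) (hd.clm_apply_vec v) hline
  refine h1.unique ((hasDerivAt_const (0 : ℝ) (0 : ℝ)).congr_of_eventuallyEq ?_)
  -- The line `x₀ + ε s` consists of similar configurations with scale factor `1 + ε a`, nonzero for
  -- small `ε`.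
  have hcont : ContinuousAt (fun ε : ℝ => 1 + (ε : ℂ) * a) 0 := by fun_prop
  filter_upwards [hcont.eventually_ne (by simp : (1 : ℂ) + ((0 : ℝ) : ℂ) * a ≠ 0)] with ε hε
  have heq : x₀ + ε • s = (1 + (ε : ℂ) * a) • x₀ + ((ε : ℂ) * b) • fun _ => (1 : ℂ) := by
    funext i
    simp only [hs_def, Pi.add_apply, Pi.smul_apply, smul_eq_mul, Complex.real_smul]
    ring
  rw [heq, fderiv_newtonU_similar_eq_zero hm hcc hv hε]

/-- Since `S` and `D` are complex subspaces, scaling reduces the claim to their Hessian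
orthogonality at `x₀`; symmetry of the Hessian finishes. -/
theorem hessU_smul_mem_spaceD (hm : ∀ i, 0 < m i) (hcc : IsCentralConfiguration m x₀) {z : ℂ}
    (hz : z ≠ 0) {v : Conf n} (hv : v ∈ spaceD m x₀) : hessU m (z • x₀) v ∈ spaceD m x₀ := by
  rw [mem_spaceD_iff]
  intro s hs
  have hzx : z • x₀ ∈ collisionFree n := by
    simpa using smul_add_const_mem_collisionFree hcc.1 hz 0
  have h := fderiv_fderiv_newtonU_smul m hz hcc.1 (z⁻¹ • s) (z⁻¹ • v)
  rw [fderiv_fderiv_newtonU_similar_eq_zero hm hcc (smul_mem_similarSpace _ hs)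
    (smul_mem_spaceD _ hv), smul_inv_smul₀ hz, smul_inv_smul₀ hz, mul_zero] at h
  rw [← massInner_hessU_comm hm hzx, massInner_hessU m hm, h]

theorem massInner_hessU_smul_pos (hm : ∀ i, 0 < m i) (hcc : IsCentralConfiguration m x₀)
    (hnd : IsStronglyNondegenerate m x₀) {z : ℂ} (hz : z ≠ 0) {v : Conf n}
    (hv : v ∈ spaceD m x₀) (hv0 : v ≠ 0) : 0 < massInner m (hessU m (z • x₀) v) v := by
  have h := fderiv_fderiv_newtonU_smul m hz hcc.1 (z⁻¹ • v) (z⁻¹ • v)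
  rw [smul_inv_smul₀ hz, ← massInner_hessU m hm, ← massInner_hessU m hm] at h
  rw [h]
  exact mul_pos (inv_pos.2 (norm_pos_iff.2 hz))
    (hnd _ (smul_mem_spaceD _ hv) (smul_ne_zero (inv_ne_zero hz) hv0))

/-- With at most one body, being collision-free does not prevent `z(t) = 0`; this disposes of that
case. -/
theorem spaceD_eq_bot_of_le_one (hm : ∀ i, 0 < m i) (hn : n ≤ 1) : spaceD m x₀ = ⊥ := by
  rw [Submodule.eq_bot_iff]
  intro v hv
  by_contra hv0
  have : Subsingleton (Fin n) := Fin.subsingleton_iff_le_one.2 hn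
  obtain ⟨i, -⟩ := Function.ne_iff.1 hv0
  have hvS : v ∈ similarSpace x₀ := mem_similarSpace_iff.2 ⟨0, v i, by
    funext j
    simp [Subsingleton.elim j i]⟩
  exact (massInner_self_pos hm hv0).ne' (mem_spaceD_iff.1 hv v hvS)

/-- Four real vectors span `S`, so `D` is cut out by four equations in real dimension `2n ≥ 6`. -/
theorem spaceD_ne_bot (hn : 3 ≤ n) : spaceD m x₀ ≠ ⊥ := by
  set one : Conf n := fun _ => 1
  set L : Conf n →ₗ[ℝ] (Fin 4 → ℝ) := LinearMap.pi
    ![massInner m x₀, massInner m (Complex.I • x₀), massInner m one,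
      massInner m (Complex.I • one)]
  have hlt : Module.finrank ℝ (Fin 4 → ℝ) < Module.finrank ℝ (Conf n) := by
    rw [Module.finrank_pi_fintype, Module.finrank_pi_fintype]
    simp only [Module.finrank_self, Complex.finrank_real_complex, Finset.sum_const,
      Finset.card_univ, Fintype.card_fin, smul_eq_mul]
    omega
  obtain ⟨v, hv, hv0⟩ := Submodule.exists_mem_ne_zero_of_ne_bot
    (LinearMap.ker_ne_bot_of_finrank_lt (f := L) hlt)
  have hL : ∀ k, L v k = 0 := fun k => congrFun hv k
  refine (Submodule.ne_bot_iff _).2 ⟨v, fun s hs => ?_, hv0⟩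
  obtain ⟨a, b, rfl⟩ := mem_similarSpace_iff.1 hs
  have hsmul : ∀ (c : ℂ) (y : Conf n), c • y = c.re • y + c.im • Complex.I • y := fun c y => by
    funext i
    simp only [Pi.add_apply, Pi.smul_apply, smul_eq_mul, Complex.real_smul]
    conv_lhs => rw [← Complex.re_add_im c]
    ring
  have h0 : massInner m x₀ v = 0 := hL 0
  have h1 : massInner m (Complex.I • x₀) v = 0 := hL 1
  have h2 : massInner m one v = 0 := hL 2
  have h3 : massInner m (Complex.I • one) v = 0 := hL 3
  change massInner m _ v = 0
  rw [hsmul a, hsmul b]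
  simp only [map_add, map_smul, LinearMap.add_apply, LinearMap.smul_apply, h0, h1]
  simp only [one] at h2 h3
  simp [h2, h3]

end CentralConfiguration

/-! ### The linearized flow: symplecticity and the increasing form `⟨J, Z⟩`. -/

section LinearizedFlow

variable {n : ℕ} {m : Fin n → ℝ}

theorem HasDerivAt.massInner {m : Fin n → ℝ} {a b : ℝ → Conf n} {a' b' : Conf n} {t : ℝ}
    (ha : HasDerivAt a a' t) (hb : HasDerivAt b b' t) :
    HasDerivAt (fun s => _root_.massInner m (a s) (b s))
      (_root_.massInner m (a t) b' + _root_.massInner m a' (b t)) t :=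
  ContinuousLinearMap.hasDerivAt_of_bilinear
    (B := LinearMap.toContinuousBilinearMap (_root_.massInner m)) (fun _ => ha) (fun _ => hb)

theorem continuous_linearizedField {x : ℝ → Conf n} (hx : ∀ t, x t ∈ collisionFree n)
    (hxc : Continuous x) : Continuous fun t => linearizedField m (x t) := by
  rw [continuous_clm_apply]
  intro w
  have hH : Continuous fun t => fderiv ℝ (fderiv ℝ (newtonU m)) (x t) :=
    continuous_iff_continuousAt.2 fun t =>
      ContinuousAt.comp (continuousAt_fderiv_fderiv_newtonU m (hx t)) hxc.continuousAt
  exact continuous_const.prodMk ((LinearMap.continuous_of_finiteDimensional (massRiesz m)).comp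
    (hH.clm_apply continuous_const))

theorem exists_isLinearizedFlow {x : ℝ → Conf n} (hx : ∀ t, x t ∈ collisionFree n)
    (hxc : Continuous x) : ∃ Φ, IsLinearizedFlow m x Φ :=
  exists_linear_flow _ (continuous_linearizedField hx hxc)

variable {x : ℝ → Conf n} {Φ : ℝ → (Conf n × Conf n) →L[ℝ] (Conf n × Conf n)}

theorem IsLinearizedFlow.hasDerivAt_apply (hΦ : IsLinearizedFlow m x Φ) (w : Conf n × Conf n)
    (t : ℝ) : HasDerivAt (fun s => Φ s w) (linearizedField m (x t) (Φ t w)) t := by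
  simpa using (hΦ.2 t).clm_apply (hasDerivAt_const t w)

theorem IsLinearizedFlow.hasDerivAt_fst (hΦ : IsLinearizedFlow m x Φ) (w : Conf n × Conf n)
    (t : ℝ) : HasDerivAt (fun s => (Φ s w).1) (Φ t w).2 t :=
  (ContinuousLinearMap.fst ℝ (Conf n) (Conf n)).hasFDerivAt.comp_hasDerivAt t
    (hΦ.hasDerivAt_apply w t)

theorem IsLinearizedFlow.hasDerivAt_snd (hΦ : IsLinearizedFlow m x Φ) (w : Conf n × Conf n)
    (t : ℝ) : HasDerivAt (fun s => (Φ s w).2) (hessU m (x t) (Φ t w).1) t :=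
  (ContinuousLinearMap.snd ℝ (Conf n) (Conf n)).hasFDerivAt.comp_hasDerivAt t
    (hΦ.hasDerivAt_apply w t)

/-- The symplectic form `⟨J, Z'⟩ - ⟨Z, J'⟩` on the phase space. -/
noncomputable def massSymplectic (m : Fin n → ℝ) : LinearMap.BilinForm ℝ (Conf n × Conf n) :=
  (massInner m).compl₁₂ (LinearMap.fst ℝ _ _) (LinearMap.snd ℝ _ _) -
    (massInner m).compl₁₂ (LinearMap.snd ℝ _ _) (LinearMap.fst ℝ _ _)

theorem massSymplectic_apply (w w' : Conf n × Conf n) :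
    massSymplectic m w w' = massInner m w.1 w'.2 - massInner m w.2 w'.1 := rfl

theorem massSymplectic_nondegenerate (hm : ∀ i, 0 < m i) : (massSymplectic m).Nondegenerate := by
  have hzero : ∀ y : Conf n, massInner m y y = 0 → y = 0 := fun y hy =>
    of_not_not fun h => (massInner_self_pos hm h).ne' hy
  constructor
  · intro w hw
    have h1 := hw (0, w.1)
    have h2 := hw (w.2, 0)
    simp only [massSymplectic_apply, map_zero, sub_zero, zero_sub, neg_eq_zero] at h1 h2
    exact Prod.ext (hzero _ h1) (hzero _ h2)
  · intro w hw
    have h1 := hw (0, w.1)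
    have h2 := hw (w.2, 0)
    simp only [massSymplectic_apply, map_zero, LinearMap.zero_apply, sub_zero, zero_sub,
      neg_eq_zero] at h1 h2
    exact Prod.ext (hzero _ h1) (hzero _ h2)

/-- The derivative of the symplectic form along two solutions vanishes because the Hessian is
symmetric. -/
theorem IsLinearizedFlow.massSymplectic_eq (hm : ∀ i, 0 < m i)
    (hx : ∀ t, x t ∈ collisionFree n) (hΦ : IsLinearizedFlow m x Φ) (t : ℝ)
    (w w' : Conf n × Conf n) : massSymplectic m (Φ t w) (Φ t w') = massSymplectic m w w' := by
  have hderiv : ∀ s, HasDerivAt (fun s => massSymplectic m (Φ s w) (Φ s w')) 0 s := fun s => by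
    refine (((hΦ.hasDerivAt_fst w s).massInner (m := m) (hΦ.hasDerivAt_snd w' s)).sub
      ((hΦ.hasDerivAt_snd w s).massInner (hΦ.hasDerivAt_fst w' s))).congr_deriv ?_
    rw [massInner_hessU_comm hm (hx s)]
    ring
  have h := is_const_of_deriv_eq_zero (fun s => (hderiv s).differentiableAt)
    (fun s => (hderiv s).deriv) t 0
  simpa [hΦ.1] using h

theorem IsLinearizedFlow.det_sq (hm : ∀ i, 0 < m i) (hx : ∀ t, x t ∈ collisionFree n)
    (hΦ : IsLinearizedFlow m x Φ) (t : ℝ) : LinearMap.det (Φ t).toLinearMap ^ 2 = 1 :=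
  det_sq_eq_one_of_comp_eq (massSymplectic_nondegenerate hm)
    (fun w w' => hΦ.massSymplectic_eq hm hx t w w')

theorem IsLinearizedFlow.hasDerivAt_massInner (hΦ : IsLinearizedFlow m x Φ)
    (w : Conf n × Conf n) (t : ℝ) :
    HasDerivAt (fun s => massInner m (Φ s w).1 (Φ s w).2)
      (massInner m (Φ t w).1 (hessU m (x t) (Φ t w).1) + massInner m (Φ t w).2 (Φ t w).2) t :=
  (hΦ.hasDerivAt_fst w t).massInner (hΦ.hasDerivAt_snd w t)

/-- If the Hessian is positive definite along the motion on an invariant subspace `D`, then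
`⟨J, Z⟩` increases strictly along every nonzero solution of the linearized equations in `D × D`. -/
theorem IsLinearizedFlow.massInner_lt (hm : ∀ i, 0 < m i) (hΦ : IsLinearizedFlow m x Φ)
    {D : Submodule ℝ (Conf n)} (hD : ∀ t, ∀ w ∈ D.prod D, Φ t w ∈ D.prod D)
    (hpos : ∀ t, ∀ v ∈ D, v ≠ 0 → 0 < massInner m (hessU m (x t) v) v) {w : Conf n × Conf n}
    (hw : w ∈ D.prod D) (hw0 : w ≠ 0) {T : ℝ} (hT : 0 < T) :
    massInner m w.1 w.2 < massInner m (Φ T w).1 (Φ T w).2 := by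
  have hself : ∀ y : Conf n, 0 ≤ massInner m y y := fun y => by
    rcases eq_or_ne y 0 with rfl | hy
    · simp
    · exact (massInner_self_pos hm hy).le
  have hhess : ∀ t, ∀ v ∈ D, 0 ≤ massInner m v (hessU m (x t) v) := fun t v hv => by
    rcases eq_or_ne v 0 with rfl | hv0
    · simp
    · rw [massInner_comm]
      exact (hpos t v hv hv0).le
  have hmono : Monotone fun s => massInner m (Φ s w).1 (Φ s w).2 :=
    monotone_of_hasDerivAt_nonneg (hΦ.hasDerivAt_massInner w) fun t =>
      add_nonneg (hhess t _ (hD t w hw).1) (hself _)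
  have h0 : Φ 0 w = w := by rw [hΦ.1]; rfl
  have hle := hmono hT.le
  simp only [h0] at hle
  refine lt_of_le_of_ne hle fun heq => ?_
  have hderiv := hΦ.hasDerivAt_massInner w 0
  -- A monotone function with equal values at `0` and `T` is constant between them, so its
  -- derivative at `0` vanishes; but there it is `⟨J, HU J⟩ + ⟨Z, Z⟩ > 0`.
  have hconst : HasDerivWithinAt (fun s => massInner m (Φ s w).1 (Φ s w).2) 0 (Icc 0 T) 0 := by
    refine (hasDerivWithinAt_const 0 (Icc 0 T) (massInner m w.1 w.2)).congr
      (fun s hs => ?_) (by rw [h0])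
    have h1 := hmono hs.1
    have h2 := hmono hs.2
    simp only [h0] at h1 h2
    linarith
  have hzero := (uniqueDiffOn_Icc hT 0 (left_mem_Icc.2 hT.le)).eq_deriv _
    hderiv.hasDerivWithinAt hconst
  rw [h0] at hzero
  rcases eq_or_ne w.1 0 with h | h
  · have h2 : w.2 ≠ 0 := fun h2 => hw0 (Prod.ext h h2)
    have := hhess 0 w.1 hw.1
    linarith [massInner_self_pos hm h2]
  · have := hpos 0 w.1 hw.1 h
    rw [massInner_comm] at this
    linarith [hself w.2]

/-- An endomorphism along which a quadratic form strictly increases is hyperbolic. -/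
theorem isHyperbolicEnd_of_lt {W : Type*} [AddCommGroup W] [Module ℝ W]
    {B : LinearMap.BilinForm ℝ W} {f : W →ₗ[ℝ] W}
    (hf : ∀ w, w ≠ 0 → B w w < B (f w) (f w)) : IsHyperbolicEnd f := by
  intro μ hμ hμ1
  obtain ⟨a, b, hab, ha, hb⟩ := (hasEigenvalue_baseChange_iff f μ).1 hμ
  have hle : ∀ w, B w w ≤ B (f w) (f w) := fun w => by
    rcases eq_or_ne w 0 with rfl | hw
    · simp
    · exact (hf w hw).le
  have hnorm : μ.re * μ.re + μ.im * μ.im = 1 := by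
    rw [← Complex.normSq_apply, Complex.normSq_eq_norm_sq, hμ1, one_pow]
  -- On the span of `a` and `b`, `f` acts as a rotation; the cross terms cancel in the sum even for
  -- non-symmetric `B`.
  have hsum : B (f a) (f a) + B (f b) (f b) = B a a + B b b := by
    rw [ha, hb]
    simp only [map_add, map_sub, map_smul, LinearMap.add_apply, LinearMap.sub_apply,
      LinearMap.smul_apply, smul_eq_mul]
    linear_combination (B a a + B b b) * hnorm
  rcases hab with h | h
  · linarith [hf a h, hle b]
  · linarith [hf b h, hle a]

end LinearizedFlow

theorem mainTheorem1 (n : ℕ) (m : Fin n → ℝ) (hm : ∀ i, 0 < m i) (x₀ : Conf n)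
    (hcc : IsCentralConfiguration m x₀) (hnd : IsStronglyNondegenerate m x₀)
    (x : ℝ → Conf n) (T : ℝ) (hx : IsEllipticHomographicMotion m x₀ x T) :
    ∃ Φ : ℝ → (Conf n × Conf n) →L[ℝ] (Conf n × Conf n),
      IsLinearizedFlow m x Φ ∧
      (∃ hinv : ∀ t, ∀ w ∈ essentialPart m x₀, (Φ t).toLinearMap w ∈ essentialPart m x₀,
        IsHyperbolicEnd ((Φ T).toLinearMap.restrict (hinv T))) ∧
      (3 ≤ n → IsLinearlyUnstable (Φ T).toLinearMap) := by
  obtain ⟨⟨hfree, v, hv, -⟩, ⟨z, hz⟩, hT, -⟩ := hx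
  have hxc : Continuous x := continuous_iff_continuousAt.2 fun t => (hv t).continuousAt
  obtain ⟨Φ, hΦ⟩ := exists_isLinearizedFlow (m := m) hfree hxc
  -- A zero of `z` would put bodies `0` and `1` both at the origin.
  have hz0 : 1 < n → ∀ t, z t ≠ 0 := fun hn t h0 => by
    refine hfree t ⟨0, by omega⟩ ⟨1, hn⟩ (by simp) ?_
    simp [hz, h0]
  have hHD : ∀ t, ∀ y ∈ spaceD m x₀, hessU m (x t) y ∈ spaceD m x₀ := fun t y hy => by
    rcases le_or_gt n 1 with hn | hn
    · rw [spaceD_eq_bot_of_le_one hm hn, Submodule.mem_bot] at hy ⊢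
      rw [hy, map_zero]
    · rw [hz]
      exact hessU_smul_mem_spaceD hm hcc (hz0 hn t) hy
  have hpos : ∀ t, ∀ y ∈ spaceD m x₀, y ≠ 0 → 0 < massInner m (hessU m (x t) y) y :=
    fun t y hy hy0 => by
      rcases le_or_gt n 1 with hn | hn
      · rw [spaceD_eq_bot_of_le_one hm hn, Submodule.mem_bot] at hy
        exact absurd hy hy0
      · rw [hz]
        exact massInner_hessU_smul_pos hm hcc hnd (hz0 hn t) hy hy0
  have hinv : ∀ t, ∀ w ∈ essentialPart m x₀, (Φ t).toLinearMap w ∈ essentialPart m x₀ :=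
    fun t w hw => mem_submodule_of_linear_ode (W := essentialPart m x₀)
      (continuous_linearizedField hfree hxc)
      (fun s y hy => ⟨hy.2, hHD s y.1 hy.1⟩) (hΦ.hasDerivAt_apply w) (by rw [hΦ.1]; exact hw) t
  have hhyp : IsHyperbolicEnd ((Φ T).toLinearMap.restrict (hinv T)) := by
    refine isHyperbolicEnd_of_lt (B := (massInner m).compl₁₂
      (LinearMap.fst ℝ _ _ ∘ₗ (essentialPart m x₀).subtype)
      (LinearMap.snd ℝ _ _ ∘ₗ (essentialPart m x₀).subtype)) fun w hw => ?_
    exact hΦ.massInner_lt hm hinv hpos w.2 (fun h => hw (Subtype.ext h)) hT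
  refine ⟨Φ, hΦ, ⟨hinv, hhyp⟩, fun hn => ?_⟩
  obtain ⟨y, hy, hy0⟩ := Submodule.exists_mem_ne_zero_of_ne_bot
    (spaceD_ne_bot (m := m) (x₀ := x₀) hn)
  -- Nontriviality guarantees a complex eigenvalue on `D × D`; hyperbolicity puts it off the unit
  -- circle.
  have hnontriv : Nontrivial (essentialPart m x₀) :=
    ⟨⟨(y, 0), hy, Submodule.zero_mem _⟩, 0, fun h => hy0 (congrArg (fun w => w.1.1) h)⟩
  obtain ⟨μ, hμ⟩ := Module.End.exists_eigenvalue
    (((Φ T).toLinearMap.restrict (hinv T)).baseChange ℂ)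
  exact isLinearlyUnstable_of_det_sq (hΦ.det_sq hm hfree T)
    (hasEigenvalue_baseChange_of_restrict (hinv T) hμ) (hhyp μ hμ)
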